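/- For ultrafilters on $\omega$ we use the following notions. $\beta\omega$ is the Čech–Stone compactification of the discrete space $\omega$, i.e. the space of all ultrafilters on $\omega$, with $\omega\subseteq\beta\omega$ identified with the set of principal ultrafilters; for $f:\omega\to Y$ with $Y$ Tychonoff, $\widetilde f:\beta\omega\to\beta Y$ denotes its continuous extension (for $Y$ compact, $\beta Y=Y$). The Rudin–Keisler preorder: $\mathfrak u\le_{\mathrm{RK}}\mathfrak v$ iff $\mathfrak u=\widetilde f(\mathfrak v)$ for some $f:\omega\to\omega$; $\tau(\mathfrak u)$ is the equivalence class of $\mathfrak u$ under ${\approx_{\mathrm{RK}}}={\le_{\mathrm{RK}}}\cap{\ge_{\mathrm{RK}}}$. A non-principal $\mathfrak u\in\beta\omega$ is Ramsey if every non-principal $\mathfrak v\le_{\mathrm{RK}}\mathfrak u$ satisfies $\mathfrak v\approx_{\mathrm{RK}}\mathfrak u$. The Comfort preorder: a Tychonoff space $Y$ is $\mathfrak u$-compact iff $\widetilde f(\mathfrak u)\in Y$ for every $f:\omega\to Y$; $\mathfrak u\le_{\mathrm C}\mathfrak v$ iff every $\mathfrak v$-compact Tychonoff space is $\mathfrak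 u$-compact. $T_{\mathrm C}(\mathfrak u)$ is the equivalence class of $\mathfrak u$ under ${\le_{\mathrm C}}\cap{\ge_{\mathrm C}}$, and $T^\tau_{\mathrm C}(\mathfrak u)=\{\tau(\mathfrak v):\mathfrak v\in T_{\mathrm C}(\mathfrak u)\}$. Let $\mathrm{DF}$ be the set of all injective $f:\omega\to\beta\omega$ with discrete range. For non-principal $\mathfrak u\in\beta\omega$ define by recursion on ordinals $W_0(\mathfrak u)=\omega$, $W_{<\alpha}(\mathfrak u)=\bigcup_{\beta<\alpha}W_\beta(\mathfrak u)$, and, for $\alpha>0$, let $W_\alpha(\mathfrak u)$ be the set of all $\widetilde f(\mathfrak u)$ with $f\in\mathrm{DF}$ such that $$\{i<\omega: f(i)\in W_{<\alpha}(\mathfrak u)\setminus W_{<\beta}(\mathfrak u)\}\in\mathfrak u\quad\text{for all }\beta<\alpha .$$ Put $W(\mathfrak u)=\bigcup_{\alpha\in\mathrm{Ord}}W_\alpha(\mathfrak u)$ and $W^\tau(\mathfrak u)=\{\tau(\mathfrak v):\mathfrak v\in W(\mathfrak u)\}$. **Theorem.** For every non-principal ultrafilter $\mathfrak u\in\beta\omega$: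 1. $W(\mathfrak u)=W_{<\omega_1}(\mathfrak u)$ and $W(\mathfrak u)\setminus\omega\subseteq T_{\mathrm C}(\mathfrak u)$; 2. if $\mathfrak u$ is Ramsey, then $W^\tau(\mathfrak u)\setminus\{\tau(0)\}=T^\tau_{\mathrm C}(\mathfrak u)$, where $\tau(0)=\omega$ is the type of the principal ultrafilters. -/

import Mathlib

universe s

/-! Ultrafilters on `ℕ`, i.e. points of `βω`, form the topological space `Ultrafilter ℕ`.  For a
compact Hausdorff space `Z` and `f : ℕ → Z`, `Ultrafilter.extend f : Ultrafilter ℕ → Z` is the unique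
continuous extension of `f` to `βω`. -/

namespace BetaOmega

/-- `ω` as a subset of `βω`: the set of principal ultrafilters. -/
def principals : Set (Ultrafilter ℕ) := Set.range (pure : ℕ → Ultrafilter ℕ)

/-- The Rudin–Keisler preorder on `βω`: `u ≤_RK v` iff `u` is the image of `v` under the
extension of some `f : ω → ω`. -/
def RKLE (u v : Ultrafilter ℕ) : Prop := ∃ f : ℕ → ℕ, v.map f = u

/-- Rudin–Keisler equivalence. -/
def RKEquiv (u v : Ultrafilter ℕ) : Prop := RKLE u v ∧ RKLE v u

/-- The type `τ(u)` of `u`: its Rudin–Keisler equivalence class. -/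
def rkType (u : Ultrafilter ℕ) : Set (Ultrafilter ℕ) := {v | RKEquiv v u}

/-- `u` is a Ramsey ultrafilter: it is non-principal and Rudin–Keisler minimal among the
non-principal ultrafilters. -/
def IsRamsey (u : Ultrafilter ℕ) : Prop :=
  u ∉ principals ∧ ∀ v : Ultrafilter ℕ, v ∉ principals → RKLE v u → RKEquiv v u

/-- `Y` is `u`-compact: for every `f : ω → Y`, the continuous extension of `f` to a map from `βω`
to the Stone–Čech compactification `βY` sends `u` into (the copy of) `Y`. -/
def UCompact (u : Ultrafilter ℕ) (Y : Type s) [TopologicalSpace Y] : Prop :=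
  ∀ f : ℕ → Y, Ultrafilter.extend (fun i => (stoneCechUnit (f i) : StoneCech Y)) u ∈
    Set.range (stoneCechUnit : Y → StoneCech Y)

/-- The Comfort preorder on `βω`: `u ≤_C v` iff every `v`-compact Tychonoff space is
`u`-compact. -/
def ComfortLE (u v : Ultrafilter ℕ) : Prop :=
  ∀ (Y : Type s) [TopologicalSpace Y] [T35Space Y], UCompact v Y → UCompact u Y

/-- The Comfort equivalence class `T_C(u)`. -/
def comfortClass (u : Ultrafilter ℕ) : Set (Ultrafilter ℕ) :=
  {v | ComfortLE.{s} v u ∧ ComfortLE.{s} u v}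

/-- The set `DF` of all injective functions `ω → βω` with discrete range. -/
def DF : Set (ℕ → Ultrafilter ℕ) :=
  {f | Function.Injective f ∧ DiscreteTopology (Set.range f)}

open Classical in
/-- The level `W_α(u)`; see `wLevel_zero` and `wLevel_of_pos` for the recursion equations. -/
noncomputable def wLevel (u : Ultrafilter ℕ) (α : Ordinal.{0}) : Set (Ultrafilter ℕ) :=
  if α = 0 then principals
  else {w | ∃ f ∈ DF, w = Ultrafilter.extend f u ∧
    ∀ β : Set.Iio α,
      {i : ℕ | f i ∈ (⋃ γ : Set.Iio α, wLevel u γ.1) \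
        (⋃ γ : {γ : Set.Iio α // γ.1 < β.1}, wLevel u γ.1.1)} ∈ u}
termination_by α
decreasing_by
  · exact γ.2
  · exact γ.1.2

/-- `W_{<α}(u)`, the union of all `W_β(u)` with `β < α`. -/
noncomputable def wBelow (u : Ultrafilter ℕ) (α : Ordinal.{0}) : Set (Ultrafilter ℕ) :=
  ⋃ β < α, wLevel u β

theorem wLevel_zero (u : Ultrafilter ℕ) : wLevel u 0 = principals := by
  rw [wLevel, if_pos rfl]

theorem wLevel_of_pos (u : Ultrafilter ℕ) {α : Ordinal.{0}} (hα : 0 < α) :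
    wLevel u α = {w | ∃ f ∈ DF, w = Ultrafilter.extend f u ∧
      ∀ β < α, {i : ℕ | f i ∈ wBelow u α \ wBelow u β} ∈ u} := by
  have h1 : (⋃ γ : Set.Iio α, wLevel u γ.1) = wBelow u α := by
    ext x; simp [wBelow]
  have h2 : ∀ β : Set.Iio α,
      (⋃ γ : {γ : Set.Iio α // γ.1 < β.1}, wLevel u γ.1.1) = wBelow u β.1 := by
    intro β
    ext x
    simp only [wBelow, Set.mem_iUnion, exists_prop]
    constructor
    · rintro ⟨γ, hx⟩
      exact ⟨γ.1.1, γ.2, hx⟩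
    · rintro ⟨γ, hγ, hx⟩
      exact ⟨⟨⟨γ, lt_trans hγ β.2⟩, hγ⟩, hx⟩
  rw [wLevel, if_neg hα.ne']
  simp only [h1, h2, Subtype.forall, Set.mem_Iio]

/-- `W(u)`, the union of all levels `W_α(u)`. -/
noncomputable def wSet (u : Ultrafilter ℕ) : Set (Ultrafilter ℕ) :=
  ⋃ α : Ordinal.{0}, wLevel u α

/-- `W^τ(u)`, the set of types of members of `W(u)`. -/
noncomputable def wTypes (u : Ultrafilter ℕ) : Set (Set (Ultrafilter ℕ)) :=
  rkType '' wSet u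

/-- `T_C^τ(u)`, the set of types of members of `T_C(u)`. -/
def comfortTypes (u : Ultrafilter ℕ) : Set (Set (Ultrafilter ℕ)) :=
  rkType '' comfortClass.{s} u

end BetaOmega

/-! Points of `W(u)` are iterated limits along `u` starting from principal ultrafilters. A limit
along `f̃(u)` is a limit along `u` of limits along the `f i`, so `u`-compactness passes to every
member of `W(u)` (`UCompact.extend`). Conversely a discrete sequence `f` has an index function that
sends `f̃(u)` back to `u`, so `u ≤_RK f̃(u)`. The levels stop at `ω₁` because countably many
countable ranks have a countable supremum.

For Ramsey `u` the key fact is that the subspace `W(u)` of `βω` is itself `u`-compact. A sequence in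
`W(u)` either attains its limit or, by `IsRamsey.exists_discrete`, is discrete on a set in `u`; it
then agrees on a set in `u` with a sequence in `DF`, whose limit lies in `W(u)`. If `v ≤_C u`, then
`W(u)` is `v`-compact, and the limit along `v` of the principal ultrafilters, which is `v`, lies in
`W(u)`. -/

namespace BetaOmega

open Filter Topology Set

/-! ### Limits along ultrafilters -/

theorem extend_eq_iff_tendsto {Z : Type*} [TopologicalSpace Z] [T2Space Z] [CompactSpace Z]
    {f : ℕ → Z} {u : Ultrafilter ℕ} {z : Z} :
    Ultrafilter.extend f u = z ↔ Tendsto f u (𝓝 z) := by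
  rw [ultrafilter_extend_eq_iff, Ultrafilter.coe_map, Tendsto]

theorem mem_extend_iff {f : ℕ → Ultrafilter ℕ} {u : Ultrafilter ℕ} {s : Set ℕ} :
    s ∈ Ultrafilter.extend f u ↔ {i | s ∈ f i} ∈ u := by
  have h : Ultrafilter.extend f u = joinM (u.map f) := by
    rw [ultrafilter_extend_eq_iff, ultrafilter_converges_iff]
  rw [h]
  rfl

theorem extend_congr {f g : ℕ → Ultrafilter ℕ} {u : Ultrafilter ℕ} (h : {i | f i = g i} ∈ u) :
    Ultrafilter.extend f u = Ultrafilter.extend g u := by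
  ext s
  rw [mem_extend_iff, mem_extend_iff]
  constructor <;> intro hs <;> filter_upwards [h, hs] with i hi hsi
  · exact hi ▸ hsi
  · exact (show f i = g i from hi) ▸ hsi

theorem uCompact_iff {u : Ultrafilter ℕ} {Y : Type s} [TopologicalSpace Y] [T35Space Y] :
    UCompact u Y ↔ ∀ f : ℕ → Y, ∃ y, Tendsto f u (𝓝 y) := by
  refine forall_congr' fun f => exists_congr fun y => ?_
  rw [eq_comm, extend_eq_iff_tendsto]
  exact (isEmbedding_stoneCechUnit.tendsto_nhds_iff (f := f)).symm

theorem mem_principals_of_singleton_mem {u : Ultrafilter ℕ} {n : ℕ} (h : {n} ∈ u) :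
    u ∈ principals :=
  ⟨n, (Ultrafilter.eq_pure_of_finite_mem (finite_singleton n) h).elim fun x hx => by
    obtain ⟨hx, rfl⟩ := hx
    rw [mem_singleton_iff.1 hx]⟩

/-! ### Rudin–Keisler reductions and the Comfort preorder -/

theorem RKLE.comfortLE {u v : Ultrafilter ℕ} (h : RKLE u v) : ComfortLE.{s} u v := by
  intro Y _ _ hY
  obtain ⟨f, rfl⟩ := h
  rw [uCompact_iff] at hY ⊢
  intro g
  obtain ⟨y, hy⟩ := hY (g ∘ f)
  exact ⟨y, by rwa [Ultrafilter.coe_map, tendsto_map'_iff]⟩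

theorem UCompact.of_mem_principals {u : Ultrafilter ℕ} (hu : u ∈ principals) (Y : Type s)
    [TopologicalSpace Y] [T35Space Y] : UCompact u Y := by
  obtain ⟨n, rfl⟩ := hu
  exact uCompact_iff.2 fun f => ⟨f n, tendsto_pure_nhds f n⟩

theorem ComfortLE.mem_principals {u v : Ultrafilter ℕ} (h : ComfortLE.{s} u v)
    (hv : v ∈ principals) : u ∈ principals := by
  -- Discrete `ω` is the test space: convergence there along `u` puts a singleton in `u`.
  obtain ⟨y, hy⟩ := uCompact_iff.1 (h (ULift.{s} ℕ) (.of_mem_principals hv _)) ULift.up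
  rw [nhds_discrete, tendsto_pure] at hy
  refine mem_principals_of_singleton_mem (n := y.down) ?_
  filter_upwards [hy] with i hi
  rw [← hi]
  rfl

theorem UCompact.extend {u : Ultrafilter ℕ} {Y : Type s} [TopologicalSpace Y] [T35Space Y]
    (hu : UCompact u Y) {f : ℕ → Ultrafilter ℕ} (hf : {i | UCompact (f i) Y} ∈ u) :
    UCompact (Ultrafilter.extend f u) Y := by
  rw [uCompact_iff] at hu ⊢
  intro g
  have hlim : ∀ i, ∃ y, UCompact (f i) Y → Tendsto g (f i) (𝓝 y) := fun i => by
    by_cases hi : UCompact (f i) Y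
    · obtain ⟨y, hy⟩ := uCompact_iff.1 hi g
      exact ⟨y, fun _ => hy⟩
    · exact ⟨g 0, fun h => absurd h hi⟩
  choose y hy using hlim
  obtain ⟨z, hz⟩ := hu y
  refine ⟨z, fun t ht => ?_⟩
  -- An open `o` is a neighbourhood of each `y i` it contains, so the two limits compose.
  obtain ⟨o, hot, ho, hzo⟩ := mem_nhds_iff.1 ht
  refine mem_of_superset (show g ⁻¹' o ∈ Ultrafilter.extend f u from mem_extend_iff.2 ?_)
    (preimage_mono hot)
  filter_upwards [hf, hz (ho.mem_nhds hzo)] with i hi hio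
  exact hy i hi (ho.mem_nhds hio)

/-! ### Discrete sequences in `βω` -/

theorem exists_mem_of_mem_DF {f : ℕ → Ultrafilter ℕ} (hf : f ∈ DF) (i : ℕ) :
    ∃ S : Set ℕ, S ∈ f i ∧ ∀ j, S ∈ f j → j = i := by
  obtain ⟨hinj, hd⟩ := hf
  obtain ⟨o, ho, hoi⟩ := isOpen_induced_iff.1
    (isOpen_discrete ({⟨f i, mem_range_self i⟩} : Set (range f)))
  have hmem : ∀ j, f j ∈ o ↔ j = i := fun j => by
    have := congrArg (fun t => (⟨f j, mem_range_self j⟩ : range f) ∈ t) hoi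
    simpa [hinj.eq_iff] using this
  obtain ⟨_, ⟨S, rfl⟩, hS, hSo⟩ :=
    ultrafilterBasis_is_basis.exists_subset_of_mem_open ((hmem i).2 rfl) ho
  exact ⟨S, hS, fun j hj => (hmem j).1 (hSo hj)⟩

theorem mem_DF_of_forall_exists {f : ℕ → Ultrafilter ℕ}
    (h : ∀ i, ∃ S : Set ℕ, S ∈ f i ∧ ∀ j, S ∈ f j → j = i) : f ∈ DF := by
  refine ⟨fun i j hij => ?_, discreteTopology_iff_isOpen_singleton.2 ?_⟩
  · obtain ⟨S, hS, hSj⟩ := h j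
    exact hSj i (hij ▸ hS)
  · rintro ⟨_, i, rfl⟩
    obtain ⟨S, hS, hSj⟩ := h i
    refine isOpen_induced_iff.2 ⟨_, ultrafilter_isOpen_basic S, ?_⟩
    ext ⟨_, j, rfl⟩
    refine ⟨fun hj => Subtype.ext (congrArg f (hSj j hj)), fun hj => ?_⟩
    have hji : f j = f i := congrArg Subtype.val hj
    change S ∈ f j
    rwa [hji]

/-- The points of a discrete sequence are told apart by a single function `ω → ω`. -/
theorem exists_index_of_mem_DF {f : ℕ → Ultrafilter ℕ} (hf : f ∈ DF) :
    ∃ h : ℕ → ℕ, ∀ i, h ⁻¹' {i} ∈ f i := by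
  classical
  choose S hS hSj using exists_mem_of_mem_DF hf
  -- The least index disjointifies the `S i`: the finitely many `S k` with `k < i` are not in `f i`,
  -- so removing them leaves a set in `f i`.
  refine ⟨fun n => sInf {i | n ∈ S i}, fun i => ?_⟩
  have hlt : ∀ᶠ n in (f i : Filter ℕ), ∀ k ∈ Finset.range i, n ∉ S k := by
    rw [Filter.eventually_all_finset]
    intro k hk
    refine Ultrafilter.compl_mem_iff_notMem.2 fun hki => ?_
    exact (Finset.mem_range.1 hk).ne' (hSj k i hki)
  filter_upwards [hS i, hlt] with n hn hlt
  refine le_antisymm (Nat.sInf_le hn) (le_of_not_gt fun hk => ?_)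
  exact hlt _ (Finset.mem_range.2 hk) (Nat.sInf_mem (s := {i | n ∈ S i}) ⟨i, hn⟩)

theorem RKLE_extend_of_mem_DF {f : ℕ → Ultrafilter ℕ} (hf : f ∈ DF) (u : Ultrafilter ℕ) :
    RKLE u (Ultrafilter.extend f u) := by
  obtain ⟨h, hh⟩ := exists_index_of_mem_DF hf
  refine ⟨h, Ultrafilter.coe_le_coe.1 fun s hs => ?_⟩
  rw [Ultrafilter.mem_coe, Ultrafilter.mem_map, mem_extend_iff]
  filter_upwards [hs] with i hi
  filter_upwards [hh i] with n hn
  rw [mem_preimage, mem_singleton_iff.1 hn]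
  exact hi

/-! ### The hierarchy `W_α(u)` -/

section Levels

variable {u : Ultrafilter ℕ}

theorem mem_wBelow {α : Ordinal.{0}} {w : Ultrafilter ℕ} :
    w ∈ wBelow u α ↔ ∃ β < α, w ∈ wLevel u β := by
  simp [wBelow]

theorem mem_wSet {w : Ultrafilter ℕ} : w ∈ wSet u ↔ ∃ α, w ∈ wLevel u α := by
  simp [wSet]

theorem RKLE_of_mem_wSet {w : Ultrafilter ℕ} (hw : w ∈ wSet u) (hw' : w ∉ principals) :
    RKLE u w := by
  obtain ⟨α, hα⟩ := mem_wSet.1 hw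
  rcases eq_zero_or_pos α with rfl | hpos
  · exact absurd (wLevel_zero u ▸ hα) hw'
  · rw [wLevel_of_pos u hpos] at hα
    obtain ⟨f, hf, rfl, -⟩ := hα
    exact RKLE_extend_of_mem_DF hf u

theorem comfortLE_of_mem_wSet {w : Ultrafilter ℕ} (hw : w ∈ wSet u) : ComfortLE.{s} w u := by
  obtain ⟨α, hα⟩ := mem_wSet.1 hw
  intro Y _ _ hY
  induction α using WellFoundedLT.induction generalizing w with
  | ind α ih =>
    rcases eq_zero_or_pos α with rfl | hpos
    · exact .of_mem_principals (wLevel_zero u ▸ hα) Y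
    · rw [wLevel_of_pos u hpos] at hα
      obtain ⟨f, hf, rfl, hfα⟩ := hα
      refine hY.extend ?_
      filter_upwards [hfα 0 hpos] with i hi
      obtain ⟨β, hβ, hiβ⟩ := mem_wBelow.1 hi.1
      exact ih β hβ (mem_wSet.2 ⟨β, hiβ⟩) hiβ

theorem wLevel_eq_empty {α : Ordinal.{0}} (hα : Ordinal.omega 1 ≤ α) : wLevel u α = ∅ := by
  induction α using WellFoundedLT.induction with
  | ind α ih =>
    have hpos : 0 < α := (Ordinal.omega_pos 1).trans_le hα
    rw [wLevel_of_pos u hpos, eq_empty_iff_forall_notMem]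
    rintro _ ⟨f, -, -, hf⟩
    have hlow : ∀ i, f i ∈ wBelow u α → ∃ β < Ordinal.omega 1, f i ∈ wLevel u β := fun i hi => by
      obtain ⟨β, hβ, hiβ⟩ := mem_wBelow.1 hi
      refine ⟨β, lt_of_not_ge fun h => ?_, hiβ⟩
      rw [ih β hβ h] at hiβ
      exact hiβ
    have hrank : ∀ i, ∃ β < Ordinal.omega 1, f i ∈ wBelow u α → f i ∈ wLevel u β := fun i => by
      by_cases hi : f i ∈ wBelow u α
      · obtain ⟨β, hβ, hiβ⟩ := hlow i hi
        exact ⟨β, hβ, fun _ => hiβ⟩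
      · exact ⟨0, Ordinal.omega_pos 1, fun h => absurd h hi⟩
    choose r hr hrf using hrank
    have hlim : Order.IsSuccLimit (Ordinal.omega 1) := Cardinal.isSuccLimit_omega 1
    -- Taking this supremum as `β` in the level condition is contradictory: every `f i` in `wBelow u
    -- α` already lies below it.
    have hsup : (⨆ i, Order.succ (r i)) < Ordinal.omega 1 :=
      Ordinal.iSup_lt_omega_one fun i => hlim.succ_lt (hr i)
    obtain ⟨i, hi, hi'⟩ := Ultrafilter.nonempty_of_mem (hf _ (hsup.trans_le hα))
    exact hi' (mem_wBelow.2 ⟨r i,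
      (Order.lt_succ (r i)).trans_le (Ordinal.le_iSup (fun i => Order.succ (r i)) i), hrf i hi⟩)

theorem wSet_eq_wBelow_omega_one : wSet u = wBelow u (Ordinal.omega 1) := by
  ext w
  rw [mem_wSet, mem_wBelow]
  refine ⟨fun ⟨α, hα⟩ => ⟨α, lt_of_not_ge fun h => ?_, hα⟩, fun ⟨α, _, hα⟩ => ⟨α, hα⟩⟩
  rw [wLevel_eq_empty h] at hα
  exact hα

theorem wSet_diff_principals_subset : wSet u \ principals ⊆ comfortClass.{s} u :=
  fun _ hw => ⟨comfortLE_of_mem_wSet hw.1, (RKLE_of_mem_wSet hw.1 hw.2).comfortLE⟩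

theorem extend_mem_wSet_of_mem_DF {f : ℕ → Ultrafilter ℕ} (hf : f ∈ DF)
    (hfu : ∀ i, f i ∈ wSet u) : Ultrafilter.extend f u ∈ wSet u := by
  have hex : ∃ α, {i | f i ∈ wBelow u α} ∈ u := ⟨Ordinal.omega 1, by
    filter_upwards with i
    exact wSet_eq_wBelow_omega_one ▸ hfu i⟩
  -- The rank of the limit is the least `α` for which `u`-almost all `f i` lie below `α`; minimality
  -- gives the condition for each `β < α`.
  obtain ⟨α, hα, hmin⟩ := WellFounded.has_min (wellFounded_lt (α := Ordinal.{0}))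
    {α | {i | f i ∈ wBelow u α} ∈ u} hex
  have hpos : 0 < α := by
    obtain ⟨i, hi⟩ := Ultrafilter.nonempty_of_mem hα
    obtain ⟨β, hβ, -⟩ := mem_wBelow.1 hi
    exact hβ.bot_lt
  refine mem_wSet.2 ⟨α, ?_⟩
  rw [wLevel_of_pos u hpos]
  refine ⟨f, hf, rfl, fun β hβ => ?_⟩
  have hβ' : {i | f i ∈ wBelow u β} ∉ u := fun h => hmin β h hβ
  filter_upwards [hα, Ultrafilter.compl_mem_iff_notMem.2 hβ'] with i h₁ h₂ using ⟨h₁, h₂⟩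

end Levels

/-! ### Self-maps fixing an ultrafilter -/

/-- One colour class lies in `u`, hence so does its preimage under `f`, but `f` switches colours on
a set in `u`. -/
theorem false_of_map_eq_of_coloring {u : Ultrafilter ℕ} {f : ℕ → ℕ} (hf : u.map f = u)
    (c : ℕ → Prop) (hc : {n | c (f n) ↔ ¬ c n} ∈ u) : False := by
  by_cases h : {n | c n} ∈ u
  · have h' : f ⁻¹' {n | c n} ∈ u := by rwa [← Ultrafilter.mem_map, hf]
    obtain ⟨n, ⟨h₁, h₂⟩, h₃⟩ := Ultrafilter.nonempty_of_mem (inter_mem (inter_mem h h') hc)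
    exact h₃.1 h₂ h₁
  · have h := Ultrafilter.compl_mem_iff_notMem.2 h
    have h' : f ⁻¹' {n | c n}ᶜ ∈ u := by rwa [← Ultrafilter.mem_map, hf]
    obtain ⟨n, ⟨h₁, h₂⟩, h₃⟩ := Ultrafilter.nonempty_of_mem (inter_mem (inter_mem h h') hc)
    exact h₂ (h₃.2 h₁)

/-- A colouring alternating along `f` wherever `f` decreases. -/
def descendColor (f : ℕ → ℕ) (n : ℕ) : Prop :=
  if f n < n then ¬ descendColor f (f n) else True
termination_by n

/-- A colouring of `{n | n ≤ N}` alternating along `f` wherever `f` increases. -/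
def ascendColor (f : ℕ → ℕ) (N n : ℕ) : Prop :=
  if n ≤ N ∧ n < f n then ¬ ascendColor f N (f n) else True
termination_by N + 1 - n

theorem eventually_eq_of_map_eq {u : Ultrafilter ℕ} {f : ℕ → ℕ} (hf : u.map f = u)
    (hu : u ∉ principals) : {n | f n = n} ∈ u := by
  by_contra hne
  have hne := Ultrafilter.compl_mem_iff_notMem.2 hne
  by_cases hlt : {n | f n < n} ∈ u
  · refine false_of_map_eq_of_coloring hf (descendColor f) ?_
    filter_upwards [hlt] with n hn
    have h : descendColor f n ↔ ¬ descendColor f (f n) := by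
      rw [descendColor, if_pos hn]
    change _ ↔ _
    tauto
  · have hgt : {n | n < f n} ∈ u := by
      filter_upwards [hne, Ultrafilter.compl_mem_iff_notMem.2 hlt] with n h₁ h₂
      exact lt_of_le_of_ne (not_lt.1 h₂) (Ne.symm h₁)
    -- Recursion along an increasing `f` has no bottom, so the colour of `n` is the limit along `u`
    -- of the colours truncated at `N`; `n ≤ N` holds for `u`-almost all `N`.
    refine false_of_map_eq_of_coloring hf (fun n => {N | ascendColor f N n} ∈ u) ?_
    filter_upwards [hgt] with n hn
    have hcofin : {N | n ≤ N} ∈ u := by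
      by_contra h
      have hfin : ({N | n ≤ N}ᶜ).Finite := (finite_lt_nat n).subset fun N hN => not_le.1 (show ¬ n ≤ N from hN)
      obtain ⟨x, -, rfl⟩ :=
        Ultrafilter.eq_pure_of_finite_mem hfin (Ultrafilter.compl_mem_iff_notMem.2 h)
      exact hu ⟨x, rfl⟩
    change _ ↔ ¬ _
    rw [← Ultrafilter.compl_mem_iff_notMem]
    have h : ∀ N, n ≤ N → (ascendColor f N n ↔ ¬ ascendColor f N (f n)) := fun N hN => by
      rw [ascendColor, if_pos ⟨hN, hn⟩]
    constructor <;> intro hs <;> filter_upwards [hcofin, hs] with N hN hsN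
    · exact fun h' => (h N hN).1 h' hsN
    · exact not_not.1 fun h' => hsN ((h N hN).2 h')

/-! ### Ramsey ultrafilters -/

/-- Minimality gives `h` with `h ∘ g` fixing `u`, so `h` is a left inverse of `g` on a set in `u`.
-/
theorem IsRamsey.exists_injOn {u : Ultrafilter ℕ} (hu : IsRamsey u) {g : ℕ → ℕ}
    (hg : ∀ n, g ⁻¹' {n} ∉ u) : ∃ A ∈ u, InjOn g A := by
  have hnp : u.map g ∉ principals := by
    rintro ⟨n, hn⟩
    refine hg n ?_
    rw [← Ultrafilter.mem_map, ← hn]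
    exact mem_singleton n
  obtain ⟨h, hh⟩ := (hu.2 _ hnp ⟨g, rfl⟩).2
  have hid := eventually_eq_of_map_eq (f := h ∘ g) (by rw [← Ultrafilter.map_map, hh]) hu.1
  refine ⟨_, hid, fun m hm n hn hmn => ?_⟩
  rw [← show h (g m) = m from hm, hmn]
  exact hn

theorem exists_injective_into_of_mem {u : Ultrafilter ℕ} (hu : u ∉ principals) {A : Set ℕ}
    (hA : A ∈ u) :
    ∃ e : ℕ → ℕ, Function.Injective e ∧ (∀ n, e n ∈ A) ∧ {n | e n = n} ∈ u := by
  classical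
  have hinf : ∀ B ∈ u, B.Infinite := fun B hB hfin => by
    obtain ⟨x, -, rfl⟩ := Ultrafilter.eq_pure_of_finite_mem hfin hB
    exact hu ⟨x, rfl⟩
  have key : ∀ B C : Set ℕ, B ⊆ A → C ⊆ A → Disjoint B C → B ∈ u → C.Infinite →
      ∃ e : ℕ → ℕ, Function.Injective e ∧ (∀ n, e n ∈ A) ∧ {n | e n = n} ∈ u := by
    intro B C hBA hCA hBC hB hC
    have hd := Set.disjoint_left.1 hBC
    let ι := hC.natEmbedding
    refine ⟨fun n => if n ∈ B then n else ι n, fun m n hmn => ?_, fun n => ?_, ?_⟩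
    · by_cases hm : m ∈ B <;> by_cases hn : n ∈ B <;> simp only [hm, hn, if_true, if_false] at hmn
      · exact hmn
      · exact absurd (hmn ▸ (ι n).2) (hd hm)
      · exact absurd (hmn ▸ (ι m).2) (hd hn)
      · exact ι.injective (Subtype.ext hmn)
    · by_cases hn : n ∈ B
      · simpa [hn] using hBA hn
      · simpa [hn] using hCA (ι n).2
    · filter_upwards [hB] with n hn
      simp [hn]
  -- Of two infinite halves of `A`, the one in `u` stays fixed, and the other has room for the rest
  -- of `ω`.
  obtain ⟨B, C, hA', hBC, hcard⟩ := (hinf A hA).exists_union_disjoint_cardinal_eq_of_infinite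
  have hBA : B ⊆ A := hA' ▸ subset_union_left
  have hCA : C ⊆ A := hA' ▸ subset_union_right
  have hinf_iff : B.Infinite ↔ C.Infinite := by
    rw [← infinite_coe_iff, ← infinite_coe_iff, Cardinal.infinite_iff, Cardinal.infinite_iff, hcard]
  rcases Ultrafilter.union_mem_iff.1 (hA' ▸ hA) with hB | hC
  · exact key B C hBA hCA hBC hB (hinf_iff.1 (hinf B hB))
  · exact key C B hCA hBA hBC.symm hC (hinf_iff.2 (hinf C hC))

/-- Over a Ramsey ultrafilter, a sequence missing its own limit is discrete on a large set. -/
theorem IsRamsey.exists_discrete {u : Ultrafilter ℕ} (hu : IsRamsey u) {f : ℕ → Ultrafilter ℕ}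
    (hf : ∀ i, f i ≠ Ultrafilter.extend f u) :
    ∃ A ∈ u, ∀ i ∈ A, ∃ S : Set ℕ, S ∈ f i ∧ ∀ j ∈ A, S ∈ f j → j = i := by
  have hsep : ∀ i, ∃ S : Set ℕ, S ∈ f i ∧ S ∉ Ultrafilter.extend f u := fun i => by
    by_contra! h
    exact hf i (Ultrafilter.coe_le_coe.1 fun s hs => h s hs).symm
  choose S hS hSp using hsep
  -- A fibre of `g` over `n` in `u` would put `S n` into the limit, so `g` is injective on a set in
  -- `u`, and its values can serve as labels separating the `f j`.
  let g : ℕ → ℕ := fun j => sInf {i | S i ∈ f j}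
  have hg : ∀ j, S (g j) ∈ f j := fun j => Nat.sInf_mem (s := {i | S i ∈ f j}) ⟨j, hS j⟩
  obtain ⟨A, hA, hinj⟩ := hu.exists_injOn (g := g) fun n hn => by
    refine hSp n (mem_extend_iff.2 ?_)
    filter_upwards [hn] with j hj
    exact mem_singleton_iff.1 hj ▸ hg j
  refine ⟨A, hA, fun i hi => ⟨{n | n ∈ S (g i) ∧ ∀ k ∈ Finset.range (g i), n ∉ S k}, ?_, ?_⟩⟩
  · have hlt : ∀ᶠ n in (f i : Filter ℕ), ∀ k ∈ Finset.range (g i), n ∉ S k := by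
      rw [Filter.eventually_all_finset]
      intro k hk
      exact Ultrafilter.compl_mem_iff_notMem.2 fun hki =>
        Nat.notMem_of_lt_sInf (Finset.mem_range.1 hk) hki
    filter_upwards [hg i, hlt] with n h₁ h₂ using ⟨h₁, h₂⟩
  · intro j hj hji
    refine hinj hj hi (le_antisymm (Nat.sInf_le ?_) (le_of_not_gt fun hlt => ?_))
    · exact mem_of_superset hji fun n hn => hn.1
    · obtain ⟨n, hn, hn'⟩ := Ultrafilter.nonempty_of_mem (inter_mem hji (hg j))
      exact hn.2 _ (Finset.mem_range.2 hlt) hn'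

theorem IsRamsey.extend_mem_wSet {u : Ultrafilter ℕ} (hu : IsRamsey u) {f : ℕ → Ultrafilter ℕ}
    (hf : ∀ i, f i ∈ wSet u) : Ultrafilter.extend f u ∈ wSet u := by
  classical
  by_cases hp : ∃ i, f i = Ultrafilter.extend f u
  · obtain ⟨i, hi⟩ := hp
    exact hi ▸ hf i
  · obtain ⟨A, hA, hdisc⟩ := hu.exists_discrete (not_exists.1 hp)
    obtain ⟨e, hinj, heA, he⟩ := exists_injective_into_of_mem hu.1 hA
    have hDF : f ∘ e ∈ DF := mem_DF_of_forall_exists fun i => by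
      obtain ⟨S, hS, hSj⟩ := hdisc (e i) (heA i)
      exact ⟨S, hS, fun j hj => hinj (hSj (e j) (heA j) hj)⟩
    have hcongr : Ultrafilter.extend f u = Ultrafilter.extend (f ∘ e) u := extend_congr <| by
      filter_upwards [he] with i hi
      exact (congrArg f hi).symm
    rw [hcongr]
    exact extend_mem_wSet_of_mem_DF hDF fun i => hf (e i)

instance t35Space_ulift (Y : Type*) [TopologicalSpace Y] [T35Space Y] :
    T35Space (ULift.{s} Y) :=
  Homeomorph.ulift.isEmbedding.t35Space

/-- The lift places `W(u)` in the universe `s` of the spaces tested by `ComfortLE`. -/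
theorem IsRamsey.uCompact_wSet {u : Ultrafilter ℕ} (hu : IsRamsey u) :
    UCompact u (ULift.{s} (wSet u)) :=
  uCompact_iff.2 fun f =>
    ⟨⟨_, hu.extend_mem_wSet (f := fun i => (f i).down) fun i => (f i).down.2⟩, by
      rw [Homeomorph.ulift.isEmbedding.tendsto_nhds_iff, tendsto_subtype_rng]
      exact extend_eq_iff_tendsto.1 rfl⟩

theorem IsRamsey.mem_wSet_of_comfortLE {u v : Ultrafilter ℕ} (hu : IsRamsey u)
    (h : ComfortLE.{s} v u) : v ∈ wSet u := by
  have hpure : ∀ n : ℕ, (pure n : Ultrafilter ℕ) ∈ wSet u := fun n =>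
    mem_wSet.2 ⟨0, by rw [wLevel_zero]; exact ⟨n, rfl⟩⟩
  obtain ⟨y, hy⟩ := uCompact_iff.1 (h _ hu.uCompact_wSet) fun n => ⟨⟨pure n, hpure n⟩⟩
  rw [Homeomorph.ulift.isEmbedding.tendsto_nhds_iff, tendsto_subtype_rng] at hy
  have : v = y.down := tendsto_nhds_unique (Ultrafilter.tendsto_pure_self v) hy
  exact this ▸ y.down.2

/-! ### Types -/

theorem rkType_eq_rkType_pure_iff {w : Ultrafilter ℕ} :
    rkType w = rkType (pure 0) ↔ w ∈ principals := by
  constructor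
  · intro h
    have hw : w ∈ rkType w := ⟨⟨id, w.map_id⟩, ⟨id, w.map_id⟩⟩
    rw [h] at hw
    obtain ⟨f, rfl⟩ := hw.1
    exact ⟨f 0, (Ultrafilter.map_pure f 0).symm⟩
  · rintro ⟨n, rfl⟩
    have hconst : ∀ (m : ℕ) (v : Ultrafilter ℕ), RKLE (pure m) v := fun m v =>
      ⟨fun _ => m, Ultrafilter.coe_injective (by simp [Filter.map_const])⟩
    have hle : ∀ (m : ℕ) (v : Ultrafilter ℕ), RKLE v (pure m) ↔ v ∈ principals := fun m v =>
      ⟨fun ⟨f, hf⟩ => ⟨f m, by rw [← hf, Ultrafilter.map_pure]⟩,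
        fun ⟨k, hk⟩ => hk ▸ hconst k _⟩
    ext v
    simp only [rkType, RKEquiv, mem_ofPred_eq, hle, hconst]

theorem IsRamsey.wTypes_diff_eq_comfortTypes {u : Ultrafilter ℕ} (hu : IsRamsey u) :
    wTypes u \ {rkType (pure 0)} = comfortTypes.{s} u := by
  ext t
  constructor
  · rintro ⟨⟨w, hw, rfl⟩, hne⟩
    rw [mem_singleton_iff, rkType_eq_rkType_pure_iff] at hne
    exact ⟨w, wSet_diff_principals_subset ⟨hw, hne⟩, rfl⟩
  · rintro ⟨v, ⟨hvu, huv⟩, rfl⟩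
    refine ⟨⟨v, hu.mem_wSet_of_comfortLE hvu, rfl⟩, ?_⟩
    rw [mem_singleton_iff, rkType_eq_rkType_pure_iff]
    exact fun hv => hu.1 (huv.mem_principals hv)

end BetaOmega

theorem mainTheorem3 (u : Ultrafilter ℕ) (hu : u ∉ BetaOmega.principals) :
    (BetaOmega.wSet u = BetaOmega.wBelow u (Ordinal.omega 1) ∧
      BetaOmega.wSet u \ BetaOmega.principals ⊆ BetaOmega.comfortClass.{s} u) ∧
    (BetaOmega.IsRamsey u →
      BetaOmega.wTypes u \ {BetaOmega.rkType (pure 0)} = BetaOmega.comfortTypes.{s} u) :=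
  ⟨⟨BetaOmega.wSet_eq_wBelow_omega_one, BetaOmega.wSet_diff_principals_subset⟩,
    fun h => h.wTypes_diff_eq_comfortTypes⟩
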